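/- Let $\mathsf A$ be a countable alphabet. A probabilistic Büchi word automaton (PBWA) over $\mathsf A$ is a tuple $\mathcal X=(X,\mathsf A,M,\iota,\mathsf{Acc})$ with a countable state set $X$, matrices $M(a)\in[0,1]^{X\times X}$ for $a\in\mathsf A$, a vector $\iota\in[0,1]^X$ and a set $\mathsf{Acc}\subseteq X$, such that $\sum_{a\in\mathsf A}\sum_{x'\in X}M(a)_{x,x'}\le 1$ for every $x\in X$, and $\sum_{x\in X}\iota_x\le 1$. Language. Put $\mathrm{NoDiv}_0(x)=1$, $\mathrm{NoDiv}_{k+1}(x)=\sum_{a}\sum_{x'}M(a)_{x,x'}\,\mathrm{NoDiv}_k(x')$ and $\mathrm{NoDiv}(x)=\lim_{k\to\infty}\mathrm{NoDiv}_k(x)$. A run is an element $\rho=(a_0,x_0)(a_1,x_1)\cdots$ of $(\mathsf A\times X)^\omega$. It is accepting if $x_i\in\mathsf{Acc}$ for infinitely many $i$. On the set of runs, with the $\sigma$-algebra generated by the cylinders, let $\mu_{\mathcal X}$ be the unique subprobability measure that gives the set of all runs extending $(a_0,x_0)\cdots(a_{i-1},x_{i-1})x_i$ the value $\iota_{x_0}\cdot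 M(a_0)_{x_0,x_1}\cdots M(a_{i-1})_{x_{i-1},x_i}\cdot\mathrm{NoDiv}(x_i)$, for all $i\ge 0$ and all such partial runs. The language $L(\mathcal X)$ is the subprobability measure on $\mathsf A^\omega$ (with the $\sigma$-algebra generated by the cylinders $w\mathsf A^\omega$, $w\in\mathsf A^*$) given by $$L(\mathcal X)(P)=\mu_{\mathcal X}\bigl(\{\rho=(a_0,x_0)(a_1,x_1)\cdots \text{ accepting}\mid a_0a_1\cdots\in P\}\bigr).$$ Fair simulation. Let $\mathcal X=(X,\mathsf A,M_{\mathcal X},\iota_{\mathcal X},\mathsf{Acc}_{\mathcal X})$ and $\mathcal Y=(Y,\mathsf A,M_{\mathcal Y},\iota_{\mathcal Y},\mathsf{Acc}_{\mathcal Y})$ be PBWAs. Put $X_1=X\setminus\mathsf{Acc}_{\mathcal X}$, $X_2=\mathsf{Acc}_{\mathcal X}$, $Y_1=Y\setminus\mathsf{Acc}_{\mathcal Y}$, $Y_2=\mathsf{Acc}_{\mathcal Y}$. For $A\in[0,1]^{Y\times X}$ let $A_{ji}$ be its $Y_j\times X_i$ part, and let $M_{\mathcal X,i}(a)$, $M_{\mathcal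 Y,j}(a)$ be the $X_i\times X$ part of $M_{\mathcal X}(a)$ and the $Y_j\times Y$ part of $M_{\mathcal Y}(a)$. Matrices and vectors are compared entrywise. The matrix $A$ is a fair simulation from $\mathcal X$ to $\mathcal Y$ if 1. $\sum_{x\in X}A_{y,x}\le 1$ for each $y\in Y$; 2. $\iota_{\mathcal X}\le\iota_{\mathcal Y}\cdot A$, and $A\cdot M_{\mathcal X}(a)\le M_{\mathcal Y}(a)\cdot A$ for each $a\in\mathsf A$; 3. there are an ordinal $\overline\alpha\le\omega$ and increasing sequences $(A_{11}^{(\alpha)})_{\alpha\le\overline\alpha}$ in $[0,1]^{Y_1\times X_1}$ and $(A_{12}^{(\alpha)})_{\alpha\le\overline\alpha}$ in $[0,1]^{Y_1\times X_2}$ such that, with $A^{(\alpha)}=\begin{pmatrix}A_{11}^{(\alpha)}&A_{12}^{(\alpha)}\\A_{21}&A_{22}\end{pmatrix}$, (a) $A_{11}^{(\overline\alpha)}=A_{11}$ and $A_{12}^{(\overline\alpha)}=A_{12}$; (b) $A_{11}^{(\alpha)}\cdot M_{\mathcal X,1}(a)\le M_{\mathcal Y,1}(a)\cdot A^{(\alpha)}$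 for all $\alpha\le\overline\alpha$ and $a\in\mathsf A$; (c) $A_{12}^{(0)}=0$; (d) $A_{12}^{(\alpha+1)}\cdot M_{\mathcal X,2}(a)\le M_{\mathcal Y,1}(a)\cdot A^{(\alpha)}$ for all $\alpha<\overline\alpha$ and $a\in\mathsf A$; (e) if $\overline\alpha=\omega$, then $(A_{12}^{(\omega)})_{y,x}=\sup_{n<\omega}(A_{12}^{(n)})_{y,x}$ for all $y\in Y_1$, $x\in X_2$. Theorem. Let $\mathcal X$ and $\mathcal Y$ be PBWAs over the same countable alphabet $\mathsf A$, where $\mathcal Y$ has a finite state set. If there is a fair simulation from $\mathcal X$ to $\mathcal Y$, then $L(\mathcal X)(P)\le L(\mathcal Y)(P)$ for every measurable $P\subseteq\mathsf A^\omega$. -/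

import Mathlib

open MeasureTheory
open scoped ENNReal

/-- A (generative) probabilistic Büchi word automaton with state space `X` and alphabet `A` (both
countable where this is used).  Entries are extended nonnegative reals; the two substochasticity
conditions force all of them into `[0,1]`, and let all sums be unconditional. -/
structure PBWA (A X : Type*) where
  /-- the transition matrix of each letter -/
  M : A → Matrix X X ℝ≥0∞
  /-- the initial distribution -/
  init : X → ℝ≥0∞
  /-- the accepting states -/
  Acc : Set X
  M_le_one : ∀ x, ∑' a, ∑' x', M a x x' ≤ 1
  init_le_one : ∑' x, init x ≤ 1

namespace PBWA

variable {A X Y : Type*}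

noncomputable section

/-! ### Runs and cylinder sets -/

/-- The partial run `(a₀,x₀)…(aᵢ₋₁,xᵢ₋₁)xᵢ` is the pair of the list `[(a₀,x₀),…,(aᵢ₋₁,xᵢ₋₁)]` and
the state `xᵢ`.  This is its first state `x₀`. -/
def firstState : List (A × X) → X → X
  | [], x => x
  | p :: _, _ => p.2

/-- The runs that extend the partial run `(l, x)`. -/
def cylRun (l : List (A × X)) (x : X) : Set (ℕ → A × X) :=
  {ρ | (∀ i (h : i < l.length), ρ i = l[i]) ∧ (ρ l.length).2 = x}

/-- Deletion of the states of a run. -/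
def delSt (ρ : ℕ → A × X) : ℕ → A := fun i => (ρ i).1

/-- The runs that visit accepting states infinitely often. -/
def accRun (𝒳 : PBWA A X) : Set (ℕ → A × X) :=
  {ρ | {i | (ρ i).2 ∈ 𝒳.Acc}.Infinite}

/-- The probability of making `k` steps without divergence. -/
def noDivUpTo (𝒳 : PBWA A X) : ℕ → X → ℝ≥0∞
  | 0, _ => 1
  | k + 1, x => ∑' a, ∑' x', 𝒳.M a x x' * noDivUpTo 𝒳 k x'

/-- The probability of no divergence: the limit of the sequence `noDivUpTo`, which is decreasing,
so that the limit is its infimum (see `noDivUpTo_antitone` and `tendsto_noDivUpTo`). -/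
def noDiv (𝒳 : PBWA A X) (x : X) : ℝ≥0∞ := ⨅ k, 𝒳.noDivUpTo k x

/-- The weight `P(ξ)` of a partial run. -/
def weight (𝒳 : PBWA A X) : List (A × X) → X → ℝ≥0∞
  | [], x => 𝒳.noDiv x
  | p :: l, x => 𝒳.M p.1 p.2 (firstState l x) * weight 𝒳 l x

theorem noDivUpTo_antitone (𝒳 : PBWA A X) (x : X) : Antitone (fun k => 𝒳.noDivUpTo k x) := by
  refine antitone_nat_of_succ_le fun k => ?_
  induction k generalizing x with
  | zero => simpa [noDivUpTo] using 𝒳.M_le_one x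
  | succ k ih =>
    rw [noDivUpTo, noDivUpTo]
    exact ENNReal.tsum_le_tsum fun a => ENNReal.tsum_le_tsum fun x' => by gcongr; exact ih x'

theorem tendsto_noDivUpTo (𝒳 : PBWA A X) (x : X) :
    Filter.Tendsto (fun k => 𝒳.noDivUpTo k x) Filter.atTop (nhds (𝒳.noDiv x)) :=
  tendsto_atTop_iInf (𝒳.noDivUpTo_antitone x)

/-! ### The measure on runs

Words and runs carry the product σ-algebras of discrete ones; for a countable alphabet and a
countable state space they are generated by the cylinder sets (`generateFrom_cylRun`). -/

theorem cylRun_cons (p : A × X) (l : List (A × X)) (x : X) (ρ : ℕ → A × X) :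
    ρ ∈ cylRun (p :: l) x ↔ ρ 0 = p ∧ (fun j => ρ (j + 1)) ∈ cylRun l x := by
  constructor
  · rintro ⟨h, h'⟩
    exact ⟨h 0 (by simp), fun i hi => h (i + 1) (Nat.succ_lt_succ hi), h'⟩
  · rintro ⟨h0, h, h'⟩
    refine ⟨fun i hi => ?_, h'⟩
    cases i with
    | zero => simpa using h0
    | succ i => exact h i (Nat.lt_of_succ_lt_succ hi)

/-- The weights of one step of the automaton, with the missing probability given to `none`. -/
def stepWeight (𝒳 : PBWA A X) (x : X) : Option (A × X) → ℝ≥0∞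
  | none => 1 - ∑' p : A × X, 𝒳.M p.1 x p.2
  | some p => 𝒳.M p.1 x p.2

theorem hasSum_stepWeight (𝒳 : PBWA A X) (x : X) : HasSum (𝒳.stepWeight x) 1 := by
  classical
  rw [ENNReal.summable.hasSum_iff, ENNReal.tsum_eq_add_tsum_ite none]
  have h : ∀ D : ∀ o : Option (A × X), Decidable (o = none),
      ∑' o : Option (A × X), @ite _ (o = none) (D o) (0 : ℝ≥0∞) (𝒳.stepWeight x o) =
        ∑' p : A × X, 𝒳.M p.1 x p.2 := fun _ => by
    rw [← (Option.some_injective (A × X)).tsum_eq]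
    · simp [stepWeight]
    · intro o ho
      cases o with
      | none => simp at ho
      | some p => exact ⟨p, rfl⟩
  refine (congrArg (_ + ·) (h _)).trans ?_
  rw [stepWeight]
  refine tsub_add_cancel_of_le ?_
  rw [ENNReal.tsum_prod (f := fun a x' => 𝒳.M a x x')]
  exact 𝒳.M_le_one x

theorem cylRun_subset {l m : List (A × X)} {x y : X} {ρ : ℕ → A × X} (hl : ρ ∈ cylRun l x)
    (hm : ρ ∈ cylRun m y) (h : l.length ≤ m.length) : cylRun m y ⊆ cylRun l x := by
  intro σ hσ
  refine ⟨fun i hi => ?_, ?_⟩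
  · rw [hσ.1 i (hi.trans_le h), ← hm.1 i (hi.trans_le h), hl.1 i hi]
  · rw [← hl.2]
    rcases h.lt_or_eq with h | h
    · rw [hσ.1 _ h, hm.1 _ h]
    · rw [h, hσ.2, hm.2]

/-- One step of the automaton, with the missing probability given to `none`. -/
def stepPMF (𝒳 : PBWA A X) (x : X) : PMF (Option (A × X)) :=
  ⟨𝒳.stepWeight x, 𝒳.hasSum_stepWeight x⟩

/-- `f (n, x)` is the step taken at time `n` if the state is then `x`; all of them are chosen
independently. -/
def choiceMeasure (𝒳 : PBWA A X) :
    @Measure (ℕ × X → Option (A × X)) (@MeasurableSpace.pi _ _ fun _ => ⊤) :=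
  let _ : MeasurableSpace (Option (A × X)) := ⊤
  Measure.infinitePi fun p : ℕ × X => (𝒳.stepPMF p.2).toMeasure

/-- The choices `f` follow the partial run `(l, y)`, when started at time `n`. -/
def follow : ℕ → List (A × X) → X → Set (ℕ × X → Option (A × X))
  | _, [], _ => Set.univ
  | n, p :: l, y => {f | f (n, p.2) = some (p.1, firstState l y)} ∩ follow (n + 1) l y

/-- The choices `f` give `k` steps without divergence, when started at time `n` in `x`. -/
def alive : ℕ → X → ℕ → Set (ℕ × X → Option (A × X))
  | _, _, 0 => Set.univ
  | n, x, k + 1 => {f | ∃ p : A × X, f (n, x) = some p ∧ f ∈ alive (n + 1) p.2 k}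

/-- The run given by the choices `f` from time `n` and state `x` on. -/
def runFrom (d : A × X) (f : ℕ × X → Option (A × X)) : ℕ → X → ℕ → A × X
  | n, x, 0 => (((f (n, x)).getD d).1, x)
  | n, x, j + 1 => runFrom d f (n + 1) ((f (n, x)).getD d).2 j

/-- The weight of a partial run, up to its last state. -/
def preWeight (𝒳 : PBWA A X) : List (A × X) → X → ℝ≥0∞
  | [], _ => 1
  | p :: l, x => 𝒳.M p.1 p.2 (firstState l x) * preWeight 𝒳 l x

theorem follow_append (p : A × X) (y : X) : ∀ (n : ℕ) (l : List (A × X)),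
    follow n (l ++ [p]) y =
      follow n l p.2 ∩ {f | f (n + l.length, p.2) = some (p.1, y)} := by
  intro n l
  induction l generalizing n with
  | nil => simp [follow, firstState]
  | cons q l ih =>
    have h : firstState (l ++ [p]) y = firstState l p.2 := by
      cases l <;> rfl
    rw [List.cons_append, follow, follow, ih, h, Set.inter_assoc]
    simp only [List.length_cons]
    rw [show n + 1 + l.length = n + (l.length + 1) by omega]

theorem preWeight_append (𝒳 : PBWA A X) (p : A × X) (y : X) (l : List (A × X)) :
    𝒳.preWeight (l ++ [p]) y = 𝒳.preWeight l p.2 * 𝒳.M p.1 p.2 y := by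
  induction l with
  | nil => simp [preWeight, firstState]
  | cons q l ih =>
    have h : firstState (l ++ [p]) y = firstState l p.2 := by
      cases l <;> rfl
    rw [List.cons_append, preWeight, preWeight, ih, h, mul_assoc]

theorem weight_eq_preWeight (𝒳 : PBWA A X) (l : List (A × X)) (x : X) :
    𝒳.weight l x = 𝒳.preWeight l x * 𝒳.noDiv x := by
  induction l with
  | nil => simp [weight, preWeight]
  | cons q l ih => rw [weight, preWeight, ih, mul_assoc]

theorem follow_eq_pi (𝒳 : PBWA A X) (l : List (A × X)) (y : X) (n : ℕ) :
    ∃ (s : Finset (ℕ × X)) (t : ℕ × X → Option (A × X)), (∀ q ∈ s, n ≤ q.1) ∧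
      follow n l y = Set.pi s (fun q => {t q}) ∧
      ∏ q ∈ s, 𝒳.stepPMF q.2 (t q) = 𝒳.preWeight l y := by
  classical
  induction l generalizing n with
  | nil => exact ⟨∅, fun _ => none, by simp, by simp [follow], by simp [preWeight]⟩
  | cons p l ih =>
    obtain ⟨s, t, hs, hf, hw⟩ := ih (n + 1)
    have hn : (n, p.2) ∉ s := fun h => by have := hs _ h; simp at this
    have ht : ∀ q ∈ s, Function.update t (n, p.2) (some (p.1, firstState l y)) q = t q :=
      fun q hq => Function.update_of_ne (fun h => hn (by rwa [h] at hq)) _ _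
    refine ⟨insert (n, p.2) s, Function.update t (n, p.2) (some (p.1, firstState l y)), ?_, ?_, ?_⟩
    · intro q hq
      rcases Finset.mem_insert.1 hq with rfl | hq
      · exact le_rfl
      · exact (Nat.le_succ n).trans (hs q hq)
    · ext f
      simp only [follow, hf, Set.mem_inter_iff, Set.mem_ofPred_eq, Set.mem_pi, Finset.mem_coe,
        Set.mem_singleton_iff, Finset.mem_insert, forall_eq_or_imp, Function.update_self]
      refine and_congr_right fun _ => forall₂_congr fun q hq => ?_
      rw [ht q hq]
    · rw [Finset.prod_insert hn, Function.update_self, preWeight, ← hw]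
      congr 1
      exact Finset.prod_congr rfl fun q hq => by rw [ht q hq]

theorem measurableSet_follow (n : ℕ) (l : List (A × X)) (y : X) :
    @MeasurableSet _ (@MeasurableSpace.pi _ (fun _ : ℕ × X => Option (A × X)) fun _ => ⊤)
      (follow n l y) := by
  let _ : MeasurableSpace (Option (A × X)) := ⊤
  induction l generalizing n with
  | nil => exact MeasurableSet.univ
  | cons p l ih =>
    exact (measurable_pi_apply (n, p.2) (MeasurableSpace.measurableSet_top
      (s := {some (p.1, firstState l y)}))).inter (ih (n + 1))

theorem measurableSet_alive [Countable A] [Countable X] (n : ℕ) (x : X) (k : ℕ) :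
    @MeasurableSet _ (@MeasurableSpace.pi _ (fun _ : ℕ × X => Option (A × X)) fun _ => ⊤)
      (alive n x k) := by
  let _ : MeasurableSpace (Option (A × X)) := ⊤
  induction k generalizing n x with
  | zero => exact MeasurableSet.univ
  | succ k ih =>
    rw [alive, Set.ofPred_exists]
    refine MeasurableSet.iUnion fun p => MeasurableSet.inter ?_ (ih (n + 1) p.2)
    exact measurable_pi_apply (X := fun _ => Option (A × X)) (n, x)
      (MeasurableSpace.measurableSet_top (s := {some p}))

theorem choiceMeasure_follow (𝒳 : PBWA A X) (l : List (A × X)) (y : X) (n : ℕ) :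
    𝒳.choiceMeasure (follow n l y) = 𝒳.preWeight l y := by
  let _ : MeasurableSpace (Option (A × X)) := ⊤
  obtain ⟨s, t, -, hf, hw⟩ := 𝒳.follow_eq_pi l y n
  rw [hf, ← hw, choiceMeasure, Measure.infinitePi_pi _
    (fun _ _ => MeasurableSpace.measurableSet_top)]
  exact Finset.prod_congr rfl fun q _ =>
    PMF.toMeasure_apply_singleton _ _ MeasurableSpace.measurableSet_top

theorem choiceMeasure_follow_alive [Countable A] [Countable X] (𝒳 : PBWA A X)
    (l : List (A × X)) (y : X) (k : ℕ) :
    𝒳.choiceMeasure (follow 0 l y ∩ alive l.length y k) =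
      𝒳.preWeight l y * 𝒳.noDivUpTo k y := by
  induction k generalizing l y with
  | zero => simp [alive, noDivUpTo, choiceMeasure_follow]
  | succ k ih =>
    have h : follow 0 l y ∩ alive l.length y (k + 1) =
        ⋃ p : A × X, follow 0 (l ++ [(p.1, y)]) p.2 ∩
          alive (l ++ [(p.1, y)]).length p.2 k := by
      ext f
      simp only [follow_append, alive, List.length_append, List.length_singleton, Set.mem_iUnion,
        Set.mem_inter_iff, Set.mem_ofPred_eq, zero_add]
      constructor
      · rintro ⟨h1, p, h2, h3⟩
        exact ⟨p, ⟨h1, h2⟩, h3⟩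
      · rintro ⟨p, ⟨h1, h2⟩, h3⟩
        exact ⟨h1, p, h2, h3⟩
    rw [h, measure_iUnion _ fun p => (measurableSet_follow _ _ _).inter (measurableSet_alive _ _ _)]
    · simp only [ih, preWeight_append, noDivUpTo]
      rw [ENNReal.tsum_prod (f := fun a x' => 𝒳.preWeight l y * 𝒳.M a y x' * 𝒳.noDivUpTo k x')]
      simp only [mul_assoc, ENNReal.tsum_mul_left]
    · intro p q hpq
      refine Set.disjoint_left.2 fun f hp hq => hpq ?_
      simp only [follow_append, Set.mem_inter_iff, Set.mem_ofPred_eq] at hp hq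
      have := hp.1.2.symm.trans hq.1.2
      simpa using this

theorem alive_add (f : ℕ × X → Option (A × X)) (n : ℕ) (l : List (A × X)) (y : X) (k : ℕ)
    (h : f ∈ follow n l y) :
    f ∈ alive n (firstState l y) (l.length + k) ↔ f ∈ alive (n + l.length) y k := by
  induction l generalizing n with
  | nil => simp [firstState]
  | cons p l ih =>
    have h1 : f (n, p.2) = some (p.1, firstState l y) := h.1
    rw [List.length_cons, show l.length + 1 + k = (l.length + k) + 1 by omega,
      show n + (l.length + 1) = n + 1 + l.length by omega, ← ih (n + 1) h.2]
    simp [alive, firstState, h1]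

theorem alive_antitone (f : ℕ × X → Option (A × X)) (n : ℕ) (x : X) (k : ℕ)
    (h : f ∈ alive n x (k + 1)) : f ∈ alive n x k := by
  induction k generalizing n x with
  | zero => trivial
  | succ k ih =>
    obtain ⟨p, hp, hp'⟩ := h
    exact ⟨p, hp, ih _ _ hp'⟩

theorem runFrom_mem_cylRun (d : A × X) (f : ℕ × X → Option (A × X)) (l : List (A × X)) (y : X)
    (n : ℕ) (x : X) (h : ∀ k, f ∈ alive n x k) :
    runFrom d f n x ∈ cylRun l y ↔ firstState l y = x ∧ f ∈ follow n l y := by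
  induction l generalizing n x with
  | nil => simp [cylRun, runFrom, firstState, follow, eq_comm]
  | cons p l ih =>
    obtain ⟨q, hq, -⟩ := h 1
    have h' : ∀ k, f ∈ alive (n + 1) q.2 k := fun k => by
      obtain ⟨q', hq', hk⟩ := h (k + 1)
      rw [hq, Option.some_inj] at hq'
      rwa [hq']
    rw [cylRun_cons]
    have h1 : firstState (p :: l) y = p.2 := rfl
    rw [h1]
    simp only [runFrom, hq, Option.getD_some, follow, Set.mem_inter_iff, Set.mem_ofPred_eq]
    rw [ih (n + 1) q.2 h']
    constructor
    · rintro ⟨rfl, h2, h3⟩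
      exact ⟨rfl, by rw [hq, h2], h3⟩
    · rintro ⟨rfl, h2, h3⟩
      have h4 := Option.some_inj.1 (hq.symm.trans h2)
      exact ⟨by rw [h4], by rw [h4], h3⟩

section Measure

variable [MeasurableSpace A] [DiscreteMeasurableSpace A] [Countable A]
  [MeasurableSpace X] [DiscreteMeasurableSpace X] [Countable X]

theorem measurableSet_cylRun (l : List (A × X)) (x : X) : MeasurableSet (cylRun l x) := by
  unfold cylRun
  simp only [Set.ofPred_and, Set.ofPred_forall]
  refine .inter (.iInter fun i => .iInter fun h => ?_) ?_
  · exact measurable_pi_apply (X := fun _ => A × X) i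
      (MeasurableSet.of_discrete (s := ({l[i]} : Set (A × X))))
  · exact measurable_pi_apply (X := fun _ => A × X) l.length
      (MeasurableSet.of_discrete (s := {p : A × X | p.2 = x}))

theorem generateFrom_cylRun :
    (MeasurableSpace.pi : MeasurableSpace (ℕ → A × X)) =
      MeasurableSpace.generateFrom {s | ∃ (l : List (A × X)) (x : X), s = cylRun l x} := by
  apply le_antisymm
  · refine iSup_le fun i => ?_
    rintro _ ⟨S, -, rfl⟩
    have : (fun ρ : ℕ → A × X => ρ i) ⁻¹' S =
        ⋃ (l : List (A × X)) (x : X) (_ : ∃ h : i < l.length, l[i] ∈ S), cylRun l x := by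
      ext ρ
      simp only [Set.mem_preimage, Set.mem_iUnion]
      constructor
      · intro h
        refine ⟨(List.range (i + 1)).map ρ, (ρ (i + 1)).2, ⟨by simp, by simpa using h⟩, ?_⟩
        exact ⟨fun j hj => by simp, by simp⟩
      · rintro ⟨l, x, ⟨h, h'⟩, hρ⟩
        rwa [hρ.1 i h]
    rw [this]
    exact MeasurableSet.iUnion fun l => MeasurableSet.iUnion fun x => MeasurableSet.iUnion fun _ =>
      MeasurableSpace.measurableSet_generateFrom ⟨l, x, rfl⟩
  · refine MeasurableSpace.generateFrom_le ?_
    rintro _ ⟨l, x, rfl⟩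
    exact measurableSet_cylRun l x

theorem measurable_runFrom (d : A × X) (n : ℕ) (x : X) :
    @Measurable _ _ (@MeasurableSpace.pi _ (fun _ : ℕ × X => Option (A × X)) fun _ => ⊤) _
      (fun f => runFrom d f n x) := by
  let _ : MeasurableSpace (Option (A × X)) := ⊤
  have key : ∀ (g : Option (A × X) → A × X) (m : ℕ) (z : X),
      Measurable fun f : ℕ × X → Option (A × X) => g (f (m, z)) := fun g m z =>
    (measurable_from_top (f := g)).comp (measurable_pi_apply (m, z))
  refine measurable_pi_lambda _ fun j => ?_
  induction j generalizing n x with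
  | zero => exact key (fun o => ((o.getD d).1, x)) n x
  | succ j ih =>
    have h : Measurable fun q : X × (ℕ × X → Option (A × X)) => runFrom d q.2 (n + 1) q.1 j :=
      measurable_from_prod_countable_right fun z => ih (n + 1) z
    exact h.comp ((measurable_snd.comp (key (fun o => o.getD d) n x)).prodMk measurable_id)

theorem exists_measure_from (𝒳 : PBWA A X) (x : X) :
    ∃ μ : Measure (ℕ → A × X), ∀ l y,
      μ (cylRun l y) = {z | z = x}.indicator (fun _ => 𝒳.weight l y) (firstState l y) := by
  classical
  rcases isEmpty_or_nonempty A with hA | ⟨⟨a⟩⟩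
  · refine ⟨0, fun l y => ?_⟩
    cases l with
    | cons p l => exact hA.elim p.1
    | nil =>
      have : 𝒳.noDiv y = 0 := le_antisymm ((iInf_le _ 1).trans (by simp [noDivUpTo])) bot_le
      simp [weight, this]
  let _ : MeasurableSpace (Option (A × X)) := ⊤
  set d : A × X := (a, x)
  have hal : MeasurableSet (⋂ k, alive (A := A) 0 x k) :=
    MeasurableSet.iInter fun k => measurableSet_alive 0 x k
  refine ⟨(𝒳.choiceMeasure.restrict (⋂ k, alive 0 x k)).map (fun f => runFrom d f 0 x),
    fun l y => ?_⟩
  rw [Measure.map_apply (measurable_runFrom d 0 x) (measurableSet_cylRun l y),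
    Measure.restrict_apply' hal]
  have hmono : ∀ f, Antitone fun k => f ∈ alive (A := A) 0 x k := fun f =>
    antitone_nat_of_succ_le fun k => alive_antitone f 0 x k
  by_cases hx : firstState l y = x
  · have h : (fun f => runFrom d f 0 x) ⁻¹' cylRun l y ∩ ⋂ k, alive 0 x k =
        ⋂ k, follow 0 l y ∩ alive l.length y k := by
      ext f
      simp only [Set.mem_inter_iff, Set.mem_preimage, Set.mem_iInter]
      constructor
      · rintro ⟨h1, h2⟩ k
        have h3 := ((runFrom_mem_cylRun d f l y 0 x h2).1 h1).2
        have h4 := (alive_add f 0 l y k h3).1 (hx ▸ h2 _)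
        rw [zero_add] at h4
        exact ⟨h3, h4⟩
      · intro h1
        have h2 : ∀ k, f ∈ alive 0 x k := fun k => by
          have h3 := (alive_add f 0 l y k (h1 0).1).2 (by rw [zero_add]; exact (h1 k).2)
          rw [hx] at h3
          exact hmono f (Nat.le_add_left k l.length) h3
        exact ⟨(runFrom_mem_cylRun d f l y 0 x h2).2 ⟨hx, (h1 0).1⟩, h2⟩
    have hanti : Antitone fun k => follow (A := A) 0 l y ∩ alive l.length y k :=
      antitone_nat_of_succ_le fun k => Set.inter_subset_inter_right _
        fun f hf => alive_antitone f _ _ _ hf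
    have hfin : 𝒳.choiceMeasure (follow 0 l y ∩ alive l.length y 0) ≠ ∞ := by
      rw [choiceMeasure]
      exact measure_ne_top _ _
    rw [h, hanti.measure_iInter (fun k => ((measurableSet_follow _ _ _).inter
      (measurableSet_alive _ _ _)).nullMeasurableSet) ⟨0, hfin⟩]
    simp only [choiceMeasure_follow_alive, Set.indicator, Set.mem_ofPred_eq, hx, if_true,
      weight_eq_preWeight, noDiv]
    rcases eq_or_ne (𝒳.preWeight l y) 0 with h0 | h0
    · simp [h0]
    · rw [ENNReal.mul_iInf_of_ne h0]
      simpa [alive, choiceMeasure_follow] using hfin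
  · have h : (fun f => runFrom d f 0 x) ⁻¹' cylRun l y ∩ ⋂ k, alive 0 x k = ∅ := by
      ext f
      simp only [Set.mem_inter_iff, Set.mem_preimage, Set.mem_iInter, Set.mem_empty_iff_false,
        iff_false, not_and]
      exact fun h1 h2 => hx ((runFrom_mem_cylRun d f l y 0 x h2).1 h1).1
    simp [h, hx]

/-- There is exactly one subprobability measure on runs with `Cyl(ξ) ↦ ι(x₀) · P(ξ)`. -/
theorem existsUnique_runMeasure (𝒳 : PBWA A X) :
    ∃! μ : Measure (ℕ → A × X), μ Set.univ ≤ 1 ∧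
      ∀ l x, μ (cylRun l x) = 𝒳.init (firstState l x) * 𝒳.weight l x := by
  have huniv : ∀ μ : Measure (ℕ → A × X), μ Set.univ = ∑' x, μ (cylRun [] x) := fun μ => by
    rw [← measure_iUnion _ fun x => measurableSet_cylRun [] x]
    · congr 1
      ext ρ
      simp [cylRun]
    · intro x y hxy
      refine Set.disjoint_left.2 fun ρ hx hy => hxy ?_
      exact hx.2.symm.trans hy.2
  choose μ hμ using 𝒳.exists_measure_from
  have hcyl : ∀ l y, Measure.sum (fun x => 𝒳.init x • μ x) (cylRun l y) =
      𝒳.init (firstState l y) * 𝒳.weight l y := fun l y => by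
    rw [Measure.sum_apply _ (measurableSet_cylRun l y), tsum_eq_single (firstState l y)]
    · simp [hμ]
    · intro x hx
      simp [hμ, hx.symm]
  refine ⟨Measure.sum fun x => 𝒳.init x • μ x, ⟨?_, hcyl⟩, fun ν hν => ?_⟩
  · rw [huniv]
    simp only [hcyl]
    refine le_trans (ENNReal.tsum_le_tsum fun x => ?_) 𝒳.init_le_one
    exact mul_le_of_le_one_right' (iInf_le (fun k => 𝒳.noDivUpTo k x) 0)
  · have _ : IsFiniteMeasure ν := ⟨hν.1.trans_lt ENNReal.one_lt_top⟩
    have heq : ∀ l x, ν (cylRun l x) = Measure.sum (fun x => 𝒳.init x • μ x) (cylRun l x) :=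
      fun l x => (hν.2 l x).trans (hcyl l x).symm
    refine ext_of_generate_finite _ generateFrom_cylRun ?_ ?_ ?_
    · rintro _ ⟨l, x, rfl⟩ _ ⟨m, y, rfl⟩ ⟨ρ, h1, h2⟩
      rcases le_total l.length m.length with h | h
      · exact ⟨m, y, Set.inter_eq_right.2 (cylRun_subset h1 h2 h)⟩
      · exact ⟨l, x, Set.inter_eq_left.2 (cylRun_subset h2 h1 h)⟩
    · rintro _ ⟨l, x, rfl⟩
      exact heq l x
    · rw [huniv, huniv]
      simp only [heq]

/-- The subprobability measure on runs induced by the automaton. -/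
def runMeasure (𝒳 : PBWA A X) : Measure (ℕ → A × X) :=
  𝒳.existsUnique_runMeasure.choose

theorem runMeasure_cylRun (𝒳 : PBWA A X) (l : List (A × X)) (x : X) :
    𝒳.runMeasure (cylRun l x) = 𝒳.init (firstState l x) * 𝒳.weight l x :=
  𝒳.existsUnique_runMeasure.choose_spec.1.2 l x

/-- The language: the measure on infinite words that gives to a measurable set `P` the measure of
the accepting runs whose word is in `P` (see `language_apply`). -/
def language (𝒳 : PBWA A X) : Measure (ℕ → A) :=
  (𝒳.runMeasure.restrict 𝒳.accRun).map delSt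

theorem language_apply (𝒳 : PBWA A X) {P : Set (ℕ → A)} (hP : MeasurableSet P) :
    𝒳.language P = 𝒳.runMeasure (delSt ⁻¹' P ∩ 𝒳.accRun) := by
  have h : Measurable (delSt : (ℕ → A × X) → ℕ → A) :=
    measurable_pi_lambda _ fun i => measurable_fst.comp (measurable_pi_apply i)
  rw [language, Measure.map_apply h hP, Measure.restrict_apply (h hP)]

end Measure

/-! ### Fair matrix simulations -/

/-- The block matrix `(B₁₁ B₁₂; S₂₁ S₂₂)`, where index `1` refers to the nonaccepting states, index
`2` to the accepting ones, and `S₂₁`, `S₂₂` are the parts of `S`. -/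
def blockMatrix (𝒳 : PBWA A X) (𝒴 : PBWA A Y) (S : Matrix Y X ℝ≥0∞)
    (B₁₁ : Matrix {y // y ∉ 𝒴.Acc} {x // x ∉ 𝒳.Acc} ℝ≥0∞)
    (B₁₂ : Matrix {y // y ∉ 𝒴.Acc} {x // x ∈ 𝒳.Acc} ℝ≥0∞) : Matrix Y X ℝ≥0∞ :=
  open Classical in fun y x =>
    if hy : y ∈ 𝒴.Acc then S y x
    else if hx : x ∈ 𝒳.Acc then B₁₂ ⟨y, hy⟩ ⟨x, hx⟩
    else B₁₁ ⟨y, hy⟩ ⟨x, hx⟩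

/-- `B₁₁` and `B₁₂` (of which only the entries with index `α ≤ N` matter) are approximation
sequences of length `N ≤ ω` for the parts `S₁₁` and `S₁₂` of the matrix `S`.  The ordinals up to `ω`
are the elements of `ℕ∞`, with `ω` being `⊤`. -/
structure IsApproximation (𝒳 : PBWA A X) (𝒴 : PBWA A Y) (S : Matrix Y X ℝ≥0∞) (N : ℕ∞)
    (B₁₁ : ℕ∞ → Matrix {y // y ∉ 𝒴.Acc} {x // x ∉ 𝒳.Acc} ℝ≥0∞)
    (B₁₂ : ℕ∞ → Matrix {y // y ∉ 𝒴.Acc} {x // x ∈ 𝒳.Acc} ℝ≥0∞) : Prop where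
  mono₁₁ : ∀ α β, α ≤ β → β ≤ N → ∀ y x, B₁₁ α y x ≤ B₁₁ β y x
  mono₁₂ : ∀ α β, α ≤ β → β ≤ N → ∀ y x, B₁₂ α y x ≤ B₁₂ β y x
  last₁₁ : ∀ y x, B₁₁ N y x = S y x
  last₁₂ : ∀ y x, B₁₂ N y x = S y x
  step₁₁ : ∀ α ≤ N, ∀ (a : A) (y : {y // y ∉ 𝒴.Acc}) (z : X),
    ∑' x : {x // x ∉ 𝒳.Acc}, B₁₁ α y x * 𝒳.M a x z ≤
      ∑' y', 𝒴.M a y y' * blockMatrix 𝒳 𝒴 S (B₁₁ α) (B₁₂ α) y' z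
  base₁₂ : ∀ y x, B₁₂ 0 y x = 0
  step₁₂ : ∀ α < N, ∀ (a : A) (y : {y // y ∉ 𝒴.Acc}) (z : X),
    ∑' x : {x // x ∈ 𝒳.Acc}, B₁₂ (α + 1) y x * 𝒳.M a x z ≤
      ∑' y', 𝒴.M a y y' * blockMatrix 𝒳 𝒴 S (B₁₁ α) (B₁₂ α) y' z
  limit₁₂ : N = ⊤ → ∀ y x, B₁₂ ⊤ y x = ⨆ n : ℕ, B₁₂ n y x

/-- The matrix `S` is a fair simulation from `𝒳` to `𝒴`. -/
structure IsFairSimulation (𝒳 : PBWA A X) (𝒴 : PBWA A Y) (S : Matrix Y X ℝ≥0∞) : Prop where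
  substochastic : ∀ y, ∑' x, S y x ≤ 1
  init_le : ∀ x, 𝒳.init x ≤ ∑' y, 𝒴.init y * S y x
  step_le : ∀ (a : A) (y : Y) (z : X), ∑' x, S y x * 𝒳.M a x z ≤ ∑' y', 𝒴.M a y y' * S y' z
  approximation : ∃ (N : ℕ∞) (B₁₁ : ℕ∞ → Matrix {y // y ∉ 𝒴.Acc} {x // x ∉ 𝒳.Acc} ℝ≥0∞)
    (B₁₂ : ℕ∞ → Matrix {y // y ∉ 𝒴.Acc} {x // x ∈ 𝒳.Acc} ℝ≥0∞), IsApproximation 𝒳 𝒴 S N B₁₁ B₁₂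

end

end PBWA

/-! Call a state of `𝒴` stuck if no accepting state is reachable from it. Two facts connect fairness
with stuck states.

On the side of `𝒳`, the approximation sequences act as a ranking. Successors of a stuck state are
stuck, hence nonaccepting, so along a run of `𝒳` whose first state is related to a stuck state,
every later state is still related to some stuck state. The index of the approximation is kept at
nonaccepting states and drops at each accepting one, and index `0` relates no stuck state to an
accepting state. So such a run, if all its transitions have positive weight, is not accepting
(`IsApproximation.notMem_accRun`), and a stuck state simulates no accepted mass
(`IsFairSimulation.tsum_languageFrom_eq_zero`).

On the side of `𝒴`, finiteness and the maximum principle show that almost every run that never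
enters a stuck state is accepting (`ae_mem_accRun`).

Between the two lies the simulation with acceptance forgotten: `S` gives inclusion of trace measures
(`IsFairSimulation.tsum_trace_le`). If `k` steps are simulated before acceptance is dropped, and the
contribution of stuck states is discarded on the way, the accepted mass of `𝒳` is bounded by the
mass of the runs of `𝒴` that avoid stuck states up to time `k`
(`IsFairSimulation.tsum_languageFrom_le_forall_notMem_stuck`). Letting `k` tend to infinity gives
the inequality from each state of `𝒴`, and weighting by the initial vectors gives the theorem. -/

namespace PBWA

/-! ### Sequences with a new first entry -/

/-- The sequence `b, w 0, w 1, …`. -/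
def consSeq {B : Type*} (b : B) (w : ℕ → B) : ℕ → B
  | 0 => b
  | n + 1 => w n

theorem measurable_consSeq {B : Type*} [MeasurableSpace B] (b : B) :
    Measurable (consSeq b) := by
  refine measurable_pi_lambda _ fun n => ?_
  cases n with
  | zero => exact measurable_const
  | succ n => exact measurable_pi_apply n

theorem delSt_consSeq {A X : Type*} (p : A × X) (ρ : ℕ → A × X) :
    delSt (consSeq p ρ) = consSeq p.1 (delSt ρ) := by
  funext n
  cases n <;> rfl

theorem measurable_delSt {A X : Type*} [MeasurableSpace A] [MeasurableSpace X] :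
    Measurable (delSt : (ℕ → A × X) → ℕ → A) :=
  measurable_pi_lambda _ fun i => measurable_fst.comp (measurable_pi_apply i)

theorem mem_accRun {A X : Type*} (𝒳 : PBWA A X) (ρ : ℕ → A × X) :
    ρ ∈ 𝒳.accRun ↔ ∀ n, ∃ m ≥ n, (ρ m).2 ∈ 𝒳.Acc := by
  rw [accRun, Set.mem_ofPred_eq, ← Nat.frequently_atTop_iff_infinite, Filter.frequently_atTop]

theorem mem_accRun_iff_add {A X : Type*} (𝒳 : PBWA A X) (ρ : ℕ → A × X) (k : ℕ) :
    (fun n => ρ (n + k)) ∈ 𝒳.accRun ↔ ρ ∈ 𝒳.accRun := by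
  simp only [mem_accRun]
  constructor
  · intro h n
    obtain ⟨m, hm, h⟩ := h n
    exact ⟨m + k, by omega, h⟩
  · intro h n
    obtain ⟨m, hm, h⟩ := h (n + k)
    exact ⟨m - k, by omega, by rwa [Nat.sub_add_cancel (by omega)]⟩

theorem consSeq_mem_accRun {A X : Type*} (𝒳 : PBWA A X) (p : A × X) (ρ : ℕ → A × X) :
    consSeq p ρ ∈ 𝒳.accRun ↔ ρ ∈ 𝒳.accRun :=
  (mem_accRun_iff_add 𝒳 (consSeq p ρ) 1).symm

/-! ### Comparison of measures on infinite words -/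

/-- Inequalities, unlike equalities, do not pass from a π-system to the generated σ-algebra, since
complements reverse them. Outer regularity of the finite measure `ν` for the product of discrete
topologies reduces the claim to open sets instead. -/
theorem measure_le_of_cylinder_le {A : Type*} [Countable A] [MeasurableSpace A]
    [DiscreteMeasurableSpace A] (μ ν : Measure (ℕ → A)) [IsFiniteMeasure ν]
    (h : ∀ v n, μ (PiNat.cylinder v n) ≤ ν (PiNat.cylinder v n)) : μ ≤ ν := by
  let _ : TopologicalSpace A := ⊥
  have _ : DiscreteTopology A := ⟨rfl⟩
  have hopen : ∀ O : Set (ℕ → A), IsOpen O → μ O ≤ ν O := by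
    intro O hO
    -- The points whose cylinder of length `n` lies in `O` increase to `O` with `n`, and for fixed
    -- `n` they form a countable disjoint union of cylinders.
    have hU : O = ⋃ n, {w | PiNat.cylinder w n ⊆ O} := by
      ext w
      simp only [Set.mem_iUnion, Set.mem_ofPred_eq]
      constructor
      · intro hw
        obtain ⟨_, ⟨v, n, rfl⟩, hwv, hv⟩ :=
          (PiNat.isTopologicalBasis_cylinders fun _ => A).exists_subset_of_mem_open hw hO
        exact ⟨n, by rwa [PiNat.mem_cylinder_iff_eq.1 hwv]⟩
      · rintro ⟨n, hn⟩
        exact hn (PiNat.self_mem_cylinder w n)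
    have hmono : Monotone fun n => {w | PiNat.cylinder w n ⊆ O} :=
      fun m n hmn w hw => (PiNat.cylinder_anti w hmn).trans hw
    rw [hU, hmono.measure_iUnion, hmono.measure_iUnion]
    refine iSup_mono fun n => ?_
    let r : (ℕ → A) → (Fin n → A) := fun w i => w i
    have hr : ∀ w, r ⁻¹' {r w} = PiNat.cylinder w n := by
      intro w
      ext v
      simp only [Set.mem_preimage, Set.mem_singleton_iff, PiNat.mem_cylinder_iff, funext_iff, r]
      exact ⟨fun h i hi => h ⟨i, hi⟩, fun h i => h i i.2⟩
    have hm : ∀ c, MeasurableSet (r ⁻¹' {c}) := fun c =>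
      (measurable_pi_lambda r fun i => measurable_pi_apply (i : ℕ)) (MeasurableSet.of_discrete)
    have hs : {w | PiNat.cylinder w n ⊆ O} = ⋃ c : {c | r ⁻¹' {c} ⊆ O}, r ⁻¹' {c.1} := by
      ext w
      simp only [Set.mem_iUnion, Set.mem_ofPred_eq, ← hr]
      constructor
      · exact fun hw => ⟨⟨r w, hw⟩, rfl⟩
      · rintro ⟨⟨c, hc⟩, hw⟩
        rw [Set.mem_preimage, Set.mem_singleton_iff] at hw
        rwa [hw]
    have hd : Pairwise (Function.onFun Disjoint fun c : {c | r ⁻¹' {c} ⊆ O} => r ⁻¹' {c.1}) := by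
      intro c d hcd
      refine Set.disjoint_left.2 fun w hc hd => hcd (Subtype.ext ?_)
      exact (show r w = c.1 from hc).symm.trans hd
    rw [hs, measure_iUnion hd fun c => hm c, measure_iUnion hd fun c => hm c]
    refine ENNReal.tsum_le_tsum fun c => ?_
    rcases (r ⁻¹' {c.1}).eq_empty_or_nonempty with he | ⟨w, hw⟩
    · simp [he]
    · rw [← show r w = c.1 from hw, hr]
      exact h w n
  refine Measure.le_iff.2 fun s _ => ?_
  rw [Set.measure_eq_iInf_isOpen s ν]
  exact le_iInf₂ fun U hU => le_iInf fun hO => (measure_mono hU).trans (hopen U hO)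

/-! ### The measure on runs from a state -/

noncomputable section

variable {A X : Type*}

theorem noDiv_le_one (𝒳 : PBWA A X) (x : X) : 𝒳.noDiv x ≤ 1 :=
  iInf_le (fun k => 𝒳.noDivUpTo k x) 0

variable [MeasurableSpace A] [DiscreteMeasurableSpace A] [Countable A]
  [MeasurableSpace X] [DiscreteMeasurableSpace X] [Countable X]

/-- The subprobability measure on the runs that start in `x`. -/
def runMeasureFrom (𝒳 : PBWA A X) (x : X) : Measure (ℕ → A × X) :=
  (𝒳.exists_measure_from x).choose

theorem runMeasureFrom_cylRun (𝒳 : PBWA A X) (x : X) (l : List (A × X)) (y : X) :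
    𝒳.runMeasureFrom x (cylRun l y) =
      {z | z = x}.indicator (fun _ => 𝒳.weight l y) (firstState l y) :=
  (𝒳.exists_measure_from x).choose_spec l y

theorem measure_univ_eq_tsum_cylRun (μ : Measure (ℕ → A × X)) :
    μ Set.univ = ∑' x, μ (cylRun [] x) := by
  rw [← measure_iUnion _ fun x => measurableSet_cylRun [] x]
  · congr 1
    ext ρ
    simp [cylRun]
  · intro x y hxy
    refine Set.disjoint_left.2 fun ρ hx hy => hxy ?_
    exact hx.2.symm.trans hy.2

/-- Two cylinders that meet are nested, so the cylinders form a π-system; the total mass is the sum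
over the cylinders of length zero. -/
theorem measure_ext_cylRun (μ ν : Measure (ℕ → A × X)) [IsFiniteMeasure μ]
    (h : ∀ l x, μ (cylRun l x) = ν (cylRun l x)) : μ = ν := by
  refine ext_of_generate_finite _ generateFrom_cylRun ?_ ?_ ?_
  · rintro _ ⟨l, x, rfl⟩ _ ⟨m, y, rfl⟩ ⟨ρ, h1, h2⟩
    rcases le_total l.length m.length with h | h
    · exact ⟨m, y, Set.inter_eq_right.2 (cylRun_subset h1 h2 h)⟩
    · exact ⟨l, x, Set.inter_eq_left.2 (cylRun_subset h2 h1 h)⟩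
  · rintro _ ⟨l, x, rfl⟩
    exact h l x
  · rw [measure_univ_eq_tsum_cylRun, measure_univ_eq_tsum_cylRun]
    simp only [h]

theorem runMeasureFrom_univ (𝒳 : PBWA A X) (x : X) :
    𝒳.runMeasureFrom x Set.univ = 𝒳.noDiv x := by
  rw [measure_univ_eq_tsum_cylRun, tsum_eq_single x]
  · simp [runMeasureFrom_cylRun, firstState, weight]
  · intro y hy
    simp [runMeasureFrom_cylRun, firstState, hy]

instance (𝒳 : PBWA A X) (x : X) : IsFiniteMeasure (𝒳.runMeasureFrom x) :=
  ⟨by rw [runMeasureFrom_univ]; exact (𝒳.noDiv_le_one x).trans_lt ENNReal.one_lt_top⟩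

theorem runMeasure_eq_sum (𝒳 : PBWA A X) :
    𝒳.runMeasure = Measure.sum fun x => 𝒳.init x • 𝒳.runMeasureFrom x := by
  have _ : IsFiniteMeasure 𝒳.runMeasure :=
    ⟨𝒳.existsUnique_runMeasure.choose_spec.1.1.trans_lt ENNReal.one_lt_top⟩
  refine measure_ext_cylRun _ _ fun l y => ?_
  rw [runMeasure_cylRun, Measure.sum_apply _ (measurableSet_cylRun l y),
    tsum_eq_single (firstState l y)]
  · simp [runMeasureFrom_cylRun]
  · intro x hx
    simp [runMeasureFrom_cylRun, hx.symm]

/-- Countable additivity of the run measure, applied to the partition of the runs from `x` by first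
letter and second state, replaces an exchange of an infimum with an infinite sum. -/
theorem noDiv_eq_tsum (𝒳 : PBWA A X) (x : X) :
    𝒳.noDiv x = ∑' p : A × X, 𝒳.M p.1 x p.2 * 𝒳.noDiv p.2 := by
  have h : 𝒳.runMeasureFrom x (cylRun [] x) =
      𝒳.runMeasureFrom x (⋃ p : A × X, cylRun [(p.1, x)] p.2) := by
    congr 1
    ext ρ
    simp only [Set.mem_iUnion, cylRun_cons]
    constructor
    · exact fun h => ⟨((ρ 0).1, (ρ 1).2), Prod.ext rfl h.2, by simp [cylRun]⟩
    · rintro ⟨p, h, -⟩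
      simp [cylRun, h]
  rw [measure_iUnion _ fun p => measurableSet_cylRun _ _] at h
  · simpa [runMeasureFrom_cylRun, firstState, weight] using h
  · intro p q hpq
    refine Set.disjoint_left.2 fun ρ hp hq => hpq ?_
    rw [cylRun_cons] at hp hq
    refine Prod.ext ?_ (hp.2.2.symm.trans hq.2.2)
    simpa using hp.1.symm.trans hq.1

theorem runMeasureFrom_eq_sum (𝒳 : PBWA A X) (x : X) :
    𝒳.runMeasureFrom x = Measure.sum fun p : A × X =>
      𝒳.M p.1 x p.2 • (𝒳.runMeasureFrom p.2).map (consSeq (p.1, x)) := by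
  refine measure_ext_cylRun _ _ fun l y => ?_
  rw [Measure.sum_apply _ (measurableSet_cylRun l y)]
  simp only [Measure.smul_apply, smul_eq_mul,
    Measure.map_apply (measurable_consSeq _) (measurableSet_cylRun l y)]
  cases l with
  | nil =>
    have hpre : ∀ p : A × X, consSeq (p.1, x) ⁻¹' cylRun [] y = {_ρ | x = y} := by
      intro p
      ext ρ
      simp [cylRun, consSeq]
    by_cases hxy : x = y
    · subst hxy
      simpa [runMeasureFrom_cylRun, hpre, runMeasureFrom_univ, firstState, weight] using
        𝒳.noDiv_eq_tsum x
    · simp [runMeasureFrom_cylRun, hpre, firstState, hxy, Ne.symm hxy]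
  | cons q l =>
    have hpre : ∀ p : A × X, consSeq (p.1, x) ⁻¹' cylRun (q :: l) y =
        {ρ | (p.1, x) = q ∧ ρ ∈ cylRun l y} := by
      intro p
      ext ρ
      exact cylRun_cons _ _ _ _
    -- The cylinder already fixes the first letter and the second state, so one summand survives.
    rw [tsum_eq_single (q.1, firstState l y)]
    · rw [hpre, runMeasureFrom_cylRun]
      by_cases hx : q.2 = x
      · subst hx
        simp [firstState, weight, runMeasureFrom_cylRun]
      · have : ¬ ((q.1, x) = q) := fun h => hx (congrArg Prod.snd h).symm
        simp [firstState, hx, this]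
    · intro p hp
      rw [hpre]
      by_cases h : (p.1, x) = q
      · subst h
        have h2 : firstState l y ≠ p.2 := fun h => hp (by simp [h])
        simp [runMeasureFrom_cylRun, h2]
      · simp [h]

/-- Decomposition of the run measure by the first step. -/
theorem runMeasureFrom_apply (𝒳 : PBWA A X) (x : X) {E : Set (ℕ → A × X)}
    (hE : MeasurableSet E) :
    𝒳.runMeasureFrom x E = ∑' p : A × X,
      𝒳.M p.1 x p.2 * 𝒳.runMeasureFrom p.2 (consSeq (p.1, x) ⁻¹' E) := by
  conv_lhs => rw [runMeasureFrom_eq_sum]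
  rw [Measure.sum_apply _ hE]
  simp only [Measure.smul_apply, smul_eq_mul, Measure.map_apply (measurable_consSeq _) hE]

/-! ### Acceptance and almost sure properties of runs -/

theorem measurableSet_accRun (𝒳 : PBWA A X) : MeasurableSet 𝒳.accRun := by
  have h : 𝒳.accRun = ⋂ n, ⋃ m, ⋃ (_ : m ≥ n), {ρ | (ρ m).2 ∈ 𝒳.Acc} := by
    ext ρ
    simp [mem_accRun]
  rw [h]
  exact MeasurableSet.iInter fun n => MeasurableSet.iUnion fun m => MeasurableSet.iUnion fun _ =>
    measurable_pi_apply (X := fun _ => A × X) m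
      (MeasurableSet.of_discrete (s := {p : A × X | p.2 ∈ 𝒳.Acc}))

/-- The runs that only take transitions of positive weight. -/
def posRun (𝒳 : PBWA A X) : Set (ℕ → A × X) :=
  {ρ | ∀ i, 𝒳.M (ρ i).1 (ρ i).2 (ρ (i + 1)).2 ≠ 0}

theorem ae_start (𝒳 : PBWA A X) (x : X) : ∀ᵐ ρ ∂𝒳.runMeasureFrom x, (ρ 0).2 = x := by
  have h : MeasurableSet {ρ : ℕ → A × X | (ρ 0).2 = x}ᶜ :=
    (measurable_pi_apply (X := fun _ => A × X) 0
      (MeasurableSet.of_discrete (s := {p : A × X | p.2 = x}))).compl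
  change 𝒳.runMeasureFrom x {ρ : ℕ → A × X | (ρ 0).2 = x}ᶜ = 0
  rw [runMeasureFrom_apply _ _ h]
  have (p : A × X) : consSeq (p.1, x) ⁻¹' {ρ : ℕ → A × X | (ρ 0).2 = x}ᶜ = ∅ := by
    ext ρ
    simp [consSeq]
  simp [this]

theorem ae_posRun (𝒳 : PBWA A X) (x : X) : ∀ᵐ ρ ∂𝒳.runMeasureFrom x, ρ ∈ 𝒳.posRun := by
  refine ae_all_iff.2 fun i => ?_
  have h (i : ℕ) : MeasurableSet {ρ : ℕ → A × X | 𝒳.M (ρ i).1 (ρ i).2 (ρ (i + 1)).2 ≠ 0}ᶜ :=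
    (((measurable_pi_apply (X := fun _ => A × X) i).prodMk
      (measurable_pi_apply (X := fun _ => A × X) (i + 1)))
      (MeasurableSet.of_discrete
        (s := {p : (A × X) × (A × X) | 𝒳.M p.1.1 p.1.2 p.2.2 ≠ 0}))).compl
  change 𝒳.runMeasureFrom x {ρ : ℕ → A × X | 𝒳.M (ρ i).1 (ρ i).2 (ρ (i + 1)).2 ≠ 0}ᶜ = 0
  induction i generalizing x with
  | zero =>
    rw [runMeasureFrom_apply _ _ (h 0), ENNReal.tsum_eq_zero]
    intro p
    rcases eq_or_ne (𝒳.M p.1 x p.2) 0 with hp | hp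
    · simp [hp]
    · refine mul_eq_zero_of_right _ ?_
      refine measure_mono_null ?_ (𝒳.ae_start p.2)
      rintro ρ hρ h'
      refine hρ ?_
      change 𝒳.M p.1 x (ρ 0).2 ≠ 0
      rwa [h']
  | succ i ih =>
    rw [runMeasureFrom_apply _ _ (h _), ENNReal.tsum_eq_zero]
    intro p
    exact mul_eq_zero_of_right _ (ih p.2)

/-! ### Languages from a state -/

/-- The measure of the accepting runs from `x` whose word is in `P`. -/
def languageFrom (𝒳 : PBWA A X) (x : X) (P : Set (ℕ → A)) : ℝ≥0∞ :=
  𝒳.runMeasureFrom x (delSt ⁻¹' P ∩ 𝒳.accRun)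

theorem measurableSet_language_event (𝒳 : PBWA A X) {P : Set (ℕ → A)} (hP : MeasurableSet P) :
    MeasurableSet (delSt ⁻¹' P ∩ 𝒳.accRun) :=
  (measurable_delSt hP).inter 𝒳.measurableSet_accRun

theorem languageFrom_eq_tsum (𝒳 : PBWA A X) (x : X) {P : Set (ℕ → A)} (hP : MeasurableSet P) :
    𝒳.languageFrom x P =
      ∑' p : A × X, 𝒳.M p.1 x p.2 * 𝒳.languageFrom p.2 (consSeq p.1 ⁻¹' P) := by
  rw [languageFrom, runMeasureFrom_apply _ _ (𝒳.measurableSet_language_event hP)]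
  refine tsum_congr fun p => ?_
  rw [languageFrom]
  congr 2
  ext ρ
  simp [delSt_consSeq, consSeq_mem_accRun]

theorem language_eq_tsum (𝒳 : PBWA A X) {P : Set (ℕ → A)} (hP : MeasurableSet P) :
    𝒳.language P = ∑' x, 𝒳.init x * 𝒳.languageFrom x P := by
  rw [language_apply _ hP, runMeasure_eq_sum,
    Measure.sum_apply _ (𝒳.measurableSet_language_event hP)]
  simp [languageFrom]

end

end PBWA

namespace PBWA

noncomputable section

variable {A X Y : Type*}

theorem mem_posRun_add {𝒳 : PBWA A X} {ρ : ℕ → A × X} (h : ρ ∈ 𝒳.posRun) (k : ℕ) :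
    (fun n => ρ (n + k)) ∈ 𝒳.posRun := by
  intro i
  have := h (i + k)
  rwa [show i + k + 1 = i + 1 + k by omega] at this

/-! ### States from which no accepting state is reachable -/

/-- The states from which no accepting state can be reached with positive probability. -/
def stuck (𝒴 : PBWA A Y) : Set Y :=
  {y | ∀ z, Relation.ReflTransGen (fun u v => ∃ a, 𝒴.M a u v ≠ 0) y z → z ∉ 𝒴.Acc}

theorem notMem_acc_of_mem_stuck {𝒴 : PBWA A Y} {y : Y} (h : y ∈ 𝒴.stuck) : y ∉ 𝒴.Acc :=
  h y .refl

theorem mem_stuck_of_step {𝒴 : PBWA A Y} {y z : Y} {a : A} (h : y ∈ 𝒴.stuck)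
    (ha : 𝒴.M a y z ≠ 0) : z ∈ 𝒴.stuck :=
  fun _ hw => h _ (.head ⟨a, ha⟩ hw)

/-- Extracts the qualitative content of a simulation inequality: a positive term on the left is
matched by a positive transition into a positively related state. -/
theorem exists_ne_zero_of_tsum_le {ι κ : Type*} {f : ι → ℝ≥0∞} {g h : κ → ℝ≥0∞}
    (hle : ∑' i, f i ≤ ∑' k, g k * h k) {i : ι} (hi : f i ≠ 0) : ∃ k, g k ≠ 0 ∧ h k ≠ 0 := by
  by_contra! hc
  refine hi (le_antisymm ?_ bot_le)
  refine (ENNReal.le_tsum i).trans (hle.trans (le_of_eq (ENNReal.tsum_eq_zero.2 fun k => ?_)))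
  by_cases hk : g k = 0
  · simp [hk]
  · simp [hc k hk]

/-! ### Approximations as a ranking of states -/

section Rank

variable {𝒳 : PBWA A X} {𝒴 : PBWA A Y} {S : Matrix Y X ℝ≥0∞} {N : ℕ∞}
  {B₁₁ : ℕ∞ → Matrix {y // y ∉ 𝒴.Acc} {x // x ∉ 𝒳.Acc} ℝ≥0∞}
  {B₁₂ : ℕ∞ → Matrix {y // y ∉ 𝒴.Acc} {x // x ∈ 𝒳.Acc} ℝ≥0∞}

/-- The states related to a stuck state by the `α`-th approximation. -/
def rankSet (𝒳 : PBWA A X) (𝒴 : PBWA A Y) (S : Matrix Y X ℝ≥0∞)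
    (B₁₁ : ℕ∞ → Matrix {y // y ∉ 𝒴.Acc} {x // x ∉ 𝒳.Acc} ℝ≥0∞)
    (B₁₂ : ℕ∞ → Matrix {y // y ∉ 𝒴.Acc} {x // x ∈ 𝒳.Acc} ℝ≥0∞) (α : ℕ∞) : Set X :=
  {x | ∃ z ∈ 𝒴.stuck, blockMatrix 𝒳 𝒴 S (B₁₁ α) (B₁₂ α) z x ≠ 0}

theorem IsApproximation.rankSet_step (h : IsApproximation 𝒳 𝒴 S N B₁₁ B₁₂) {α : ℕ∞} (hα : α ≤ N)
    {x x' : X} {a : A} (hx : x ∉ 𝒳.Acc) (hr : x ∈ rankSet 𝒳 𝒴 S B₁₁ B₁₂ α)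
    (ha : 𝒳.M a x x' ≠ 0) : x' ∈ rankSet 𝒳 𝒴 S B₁₁ B₁₂ α := by
  obtain ⟨z, hz, hzx⟩ := hr
  have hz' := notMem_acc_of_mem_stuck hz
  rw [blockMatrix, dif_neg hz', dif_neg hx] at hzx
  obtain ⟨y', h1, h2⟩ := exists_ne_zero_of_tsum_le (h.step₁₁ α hα a ⟨z, hz'⟩ x')
    (i := ⟨x, hx⟩) (mul_ne_zero hzx ha)
  exact ⟨y', mem_stuck_of_step hz h1, h2⟩

theorem IsApproximation.rankSet_step_acc (h : IsApproximation 𝒳 𝒴 S N B₁₁ B₁₂) {α : ℕ∞}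
    (hα : α < N) {x x' : X} {a : A} (hx : x ∈ 𝒳.Acc)
    (hr : x ∈ rankSet 𝒳 𝒴 S B₁₁ B₁₂ (α + 1)) (ha : 𝒳.M a x x' ≠ 0) :
    x' ∈ rankSet 𝒳 𝒴 S B₁₁ B₁₂ α := by
  obtain ⟨z, hz, hzx⟩ := hr
  have hz' := notMem_acc_of_mem_stuck hz
  rw [blockMatrix, dif_neg hz', dif_pos hx] at hzx
  obtain ⟨y', h1, h2⟩ := exists_ne_zero_of_tsum_le (h.step₁₂ α hα a ⟨z, hz'⟩ x')
    (i := ⟨x, hx⟩) (mul_ne_zero hzx ha)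
  exact ⟨y', mem_stuck_of_step hz h1, h2⟩

/-- The index persists through nonaccepting states, hence up to the first accepting one. -/
theorem IsApproximation.exists_acc_mem_rankSet (h : IsApproximation 𝒳 𝒴 S N B₁₁ B₁₂) {α : ℕ∞}
    (hα : α ≤ N) {ρ : ℕ → A × X} (hpos : ρ ∈ 𝒳.posRun) (hacc : ρ ∈ 𝒳.accRun)
    (h0 : (ρ 0).2 ∈ rankSet 𝒳 𝒴 S B₁₁ B₁₂ α) :
    ∃ m, (ρ m).2 ∈ 𝒳.Acc ∧ (ρ m).2 ∈ rankSet 𝒳 𝒴 S B₁₁ B₁₂ α := by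
  classical
  have hex : ∃ m, (ρ m).2 ∈ 𝒳.Acc := by
    obtain ⟨m, -, hm⟩ := (mem_accRun 𝒳 ρ).1 hacc 0
    exact ⟨m, hm⟩
  refine ⟨Nat.find hex, Nat.find_spec hex, ?_⟩
  have key : ∀ i ≤ Nat.find hex, (ρ i).2 ∈ rankSet 𝒳 𝒴 S B₁₁ B₁₂ α := by
    intro i
    induction i with
    | zero => exact fun _ => h0
    | succ i ih => exact fun hi => h.rankSet_step hα (Nat.find_min hex hi) (ih (by omega)) (hpos i)
  exact key _ le_rfl

/-- A finite index can drop only finitely often, while an accepting run would make it drop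
infinitely often. The induction continues with the run just after its first accepting state. -/
theorem IsApproximation.notMem_accRun_of_natCast (h : IsApproximation 𝒳 𝒴 S N B₁₁ B₁₂) (n : ℕ)
    (hn : (n : ℕ∞) ≤ N) {ρ : ℕ → A × X} (hpos : ρ ∈ 𝒳.posRun)
    (h0 : (ρ 0).2 ∈ rankSet 𝒳 𝒴 S B₁₁ B₁₂ n) : ρ ∉ 𝒳.accRun := by
  intro hacc
  induction n generalizing ρ with
  | zero =>
    obtain ⟨m, hm, z, hz, hzx⟩ := h.exists_acc_mem_rankSet hn hpos hacc h0
    rw [blockMatrix, dif_neg (notMem_acc_of_mem_stuck hz), dif_pos hm] at hzx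
    exact hzx (h.base₁₂ _ _)
  | succ n ih =>
    obtain ⟨m, hm, hr⟩ := h.exists_acc_mem_rankSet hn hpos hacc h0
    have hlt : (n : ℕ∞) < N := lt_of_lt_of_le (by exact_mod_cast n.lt_succ_self) hn
    push_cast at hr
    refine ih hlt.le (mem_posRun_add hpos (m + 1)) ?_ ((mem_accRun_iff_add 𝒳 ρ (m + 1)).2 hacc)
    rw [zero_add]
    exact h.rankSet_step_acc hlt hm hr (hpos m)

theorem IsApproximation.notMem_accRun (h : IsApproximation 𝒳 𝒴 S N B₁₁ B₁₂) {ρ : ℕ → A × X}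
    (hpos : ρ ∈ 𝒳.posRun) {z : Y} (hz : z ∈ 𝒴.stuck) (hS : S z (ρ 0).2 ≠ 0) :
    ρ ∉ 𝒳.accRun := by
  have h0 : (ρ 0).2 ∈ rankSet 𝒳 𝒴 S B₁₁ B₁₂ N := by
    refine ⟨z, hz, ?_⟩
    have hz' := notMem_acc_of_mem_stuck hz
    rw [blockMatrix, dif_neg hz']
    split_ifs with hx
    · rwa [h.last₁₂]
    · rwa [h.last₁₁]
  intro hacc
  cases hN : N with
  | coe n =>
    rw [hN] at h h0
    exact h.notMem_accRun_of_natCast n le_rfl hpos h0 hacc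
  | top =>
    rw [hN] at h h0
    obtain ⟨m, hm, w, hw, hwx⟩ := h.exists_acc_mem_rankSet le_rfl hpos hacc h0
    have hw' := notMem_acc_of_mem_stuck hw
    rw [blockMatrix, dif_neg hw', dif_pos hm, h.limit₁₂ rfl] at hwx
    -- At the first accepting state the entry of index `ω` is a supremum of entries of finite index,
    -- so a positive one can be chosen and the finite case applies from there.
    obtain ⟨n, hn⟩ : ∃ n : ℕ, B₁₂ n ⟨w, hw'⟩ ⟨(ρ m).2, hm⟩ ≠ 0 := by
      by_contra! hc
      exact hwx (by simp [hc])
    refine h.notMem_accRun_of_natCast n le_top (mem_posRun_add hpos m) ?_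
      ((mem_accRun_iff_add 𝒳 ρ m).2 hacc)
    rw [zero_add]
    exact ⟨w, hw, by rwa [blockMatrix, dif_neg hw', dif_pos hm]⟩

end Rank

/-! ### One step of a simulation -/

/-- The matrix inequality integrated against a test function. The function depends on the letter
too, because the event that remains after a step does. -/
theorem IsFairSimulation.tsum_step_le {𝒳 : PBWA A X} {𝒴 : PBWA A Y} {S : Matrix Y X ℝ≥0∞}
    (h : IsFairSimulation 𝒳 𝒴 S) (y : Y) (f : A → X → ℝ≥0∞) :
    ∑' x, S y x * ∑' p : A × X, 𝒳.M p.1 x p.2 * f p.1 p.2 ≤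
      ∑' q : A × Y, 𝒴.M q.1 y q.2 * ∑' x, S q.2 x * f q.1 x :=
  calc ∑' x, S y x * ∑' p : A × X, 𝒳.M p.1 x p.2 * f p.1 p.2
      = ∑' p : A × X, (∑' x, S y x * 𝒳.M p.1 x p.2) * f p.1 p.2 := by
        simp_rw [← ENNReal.tsum_mul_left, ← ENNReal.tsum_mul_right, mul_assoc]
        exact ENNReal.tsum_comm
    _ ≤ ∑' p : A × X, (∑' y', 𝒴.M p.1 y y' * S y' p.2) * f p.1 p.2 := by
        gcongr with p
        exact h.step_le p.1 y p.2
    _ = ∑' (a : A) (y' : Y) (x : X), 𝒴.M a y y' * (S y' x * f a x) := by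
        rw [ENNReal.tsum_prod (f := fun a x => (∑' y', 𝒴.M a y y' * S y' x) * f a x)]
        refine tsum_congr fun a => ?_
        simp_rw [← ENNReal.tsum_mul_right, mul_assoc]
        exact ENNReal.tsum_comm
    _ = ∑' q : A × Y, 𝒴.M q.1 y q.2 * ∑' x, S q.2 x * f q.1 x := by
        rw [ENNReal.tsum_prod (f := fun a y' => 𝒴.M a y y' * ∑' x, S y' x * f a x)]
        simp_rw [ENNReal.tsum_mul_left]

theorem IsFairSimulation.noDivUpTo_le {𝒳 : PBWA A X} {𝒴 : PBWA A Y} {S : Matrix Y X ℝ≥0∞}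
    (h : IsFairSimulation 𝒳 𝒴 S) (k : ℕ) (y : Y) :
    ∑' x, S y x * 𝒳.noDivUpTo k x ≤ 𝒴.noDivUpTo k y := by
  induction k generalizing y with
  | zero => simpa [noDivUpTo] using h.substochastic y
  | succ k ih =>
    simp only [noDivUpTo]
    simp_rw [← ENNReal.tsum_prod (f := fun a x' => 𝒳.M a _ x' * 𝒳.noDivUpTo k x')]
    rw [← ENNReal.tsum_prod (f := fun a y' => 𝒴.M a y y' * 𝒴.noDivUpTo k y')]
    refine (h.tsum_step_le y fun _ x => 𝒳.noDivUpTo k x).trans ?_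
    gcongr with q
    exact ih q.2

theorem IsFairSimulation.noDiv_le {𝒳 : PBWA A X} {𝒴 : PBWA A Y} {S : Matrix Y X ℝ≥0∞}
    (h : IsFairSimulation 𝒳 𝒴 S) (y : Y) : ∑' x, S y x * 𝒳.noDiv x ≤ 𝒴.noDiv y := by
  refine le_iInf fun k => le_trans ?_ (h.noDivUpTo_le k y)
  gcongr with x
  exact iInf_le _ k

/-! ### Cylinders of words -/

theorem preimage_delSt_cylinder (p : A × X) (v : ℕ → A) (n : ℕ) :
    consSeq p ⁻¹' (delSt ⁻¹' PiNat.cylinder v (n + 1)) =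
      {ρ | p.1 = v 0 ∧ ρ ∈ delSt ⁻¹' PiNat.cylinder (fun i => v (i + 1)) n} := by
  ext ρ
  simp only [Set.mem_preimage, PiNat.mem_cylinder_iff, Set.mem_ofPred_eq, delSt_consSeq]
  constructor
  · exact fun h => ⟨h 0 (by omega), fun i hi => h (i + 1) (by omega)⟩
  · rintro ⟨h0, h⟩ i hi
    cases i with
    | zero => exact h0
    | succ i => exact h i (by omega)

theorem measurableSet_cylinder [MeasurableSpace A] [DiscreteMeasurableSpace A] (v : ℕ → A)
    (n : ℕ) : MeasurableSet (PiNat.cylinder v n) := by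
  rw [PiNat.cylinder_eq_pi]
  exact MeasurableSet.pi (Finset.countable_toSet _) fun i _ => MeasurableSet.of_discrete

section Measure

variable [MeasurableSpace A] [DiscreteMeasurableSpace A] [Countable A]
  [MeasurableSpace X] [DiscreteMeasurableSpace X] [Countable X]

theorem IsFairSimulation.tsum_languageFrom_eq_zero {𝒳 : PBWA A X} {𝒴 : PBWA A Y}
    {S : Matrix Y X ℝ≥0∞} (h : IsFairSimulation 𝒳 𝒴 S) {z : Y} (hz : z ∈ 𝒴.stuck)
    (P : Set (ℕ → A)) : ∑' x, S z x * 𝒳.languageFrom x P = 0 := by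
  obtain ⟨N, B₁₁, B₁₂, hB⟩ := h.approximation
  refine ENNReal.tsum_eq_zero.2 fun x => ?_
  rcases eq_or_ne (S z x) 0 with hS | hS
  · simp [hS]
  refine mul_eq_zero_of_right _ ?_
  have : ∀ᵐ ρ ∂𝒳.runMeasureFrom x, ρ ∉ 𝒳.accRun := by
    filter_upwards [𝒳.ae_start x, 𝒳.ae_posRun x] with ρ h0 hpos
    exact hB.notMem_accRun hpos hz (h0.symm ▸ hS)
  exact measure_mono_null (fun ρ hρ => not_not.2 hρ.2) this

variable [MeasurableSpace Y] [DiscreteMeasurableSpace Y]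

/-! ### Almost sure behaviour of finite automata -/

/-- The runs that avoid accepting and stuck states. -/
def undecided (𝒴 : PBWA A Y) : Set (ℕ → A × Y) :=
  {ρ | ∀ i, (ρ i).2 ∉ 𝒴.Acc ∪ 𝒴.stuck}

theorem measurableSet_undecided [Countable Y] (𝒴 : PBWA A Y) : MeasurableSet 𝒴.undecided := by
  rw [undecided, Set.ofPred_forall]
  exact MeasurableSet.iInter fun i => measurable_pi_apply (X := fun _ => A × Y) i
    (MeasurableSet.of_discrete (s := {p : A × Y | p.2 ∉ 𝒴.Acc ∪ 𝒴.stuck}))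

/-- By the maximum principle, almost every run of a finite automaton reaches an accepting or a stuck
state. -/
theorem runMeasureFrom_undecided [Finite Y] (𝒴 : PBWA A Y) (y : Y) :
    𝒴.runMeasureFrom y 𝒴.undecided = 0 := by
  set d : Y → ℝ≥0∞ := fun y => 𝒴.runMeasureFrom y 𝒴.undecided
  have hzero : ∀ z ∈ 𝒴.Acc ∪ 𝒴.stuck, d z = 0 := by
    intro z hz
    refine measure_mono_null ?_ (𝒴.ae_start z)
    intro ρ hρ h0
    exact hρ 0 (h0 ▸ hz)
  -- Dropping the constraint at time `0` makes `d` subharmonic.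
  have hstep : ∀ y, d y ≤ ∑' p : A × Y, 𝒴.M p.1 y p.2 * d p.2 := by
    intro y
    refine (𝒴.runMeasureFrom_apply y 𝒴.measurableSet_undecided).trans_le ?_
    exact ENNReal.tsum_le_tsum fun p =>
      mul_le_mul' le_rfl (measure_mono fun ρ hρ i => hρ (i + 1))
  have _ : Nonempty Y := ⟨y⟩
  obtain ⟨y₀, hmax⟩ := Finite.exists_max d
  have hfin : d y₀ ≠ ∞ := measure_ne_top _ _
  suffices h0 : d y₀ = 0 from le_antisymm ((hmax y).trans h0.le) bot_le
  by_contra hne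
  -- A maximum passes to every successor of positive weight: one smaller successor would make the
  -- substochastic average strictly smaller than the maximum. A nonzero maximum would thus reach an
  -- accepting state, where `d` vanishes.
  have hsucc : ∀ u v, (∃ a, 𝒴.M a u v ≠ 0) → d u = d y₀ → d v = d y₀ := by
    rintro u v ⟨a, ha⟩ hu
    by_contra hv
    have hlt : d v < d y₀ := lt_of_le_of_ne (hmax v) hv
    have hsum : ∑' p : A × Y, 𝒴.M p.1 u p.2 * d y₀ ≤ d y₀ := by
      rw [ENNReal.tsum_mul_right, ENNReal.tsum_prod (f := fun a v => 𝒴.M a u v)]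
      exact mul_le_of_le_one_left' (𝒴.M_le_one u)
    have hM : 𝒴.M a u v ≠ ∞ := by
      refine ne_top_of_le_ne_top ENNReal.one_ne_top (le_trans ?_ (𝒴.M_le_one u))
      exact (ENNReal.le_tsum v).trans (ENNReal.le_tsum (f := fun a => ∑' v, 𝒴.M a u v) a)
    have : ∑' p : A × Y, 𝒴.M p.1 u p.2 * d p.2 < ∑' p : A × Y, 𝒴.M p.1 u p.2 * d y₀ := by
      refine ENNReal.tsum_lt_tsum (i := (a, v)) ?_ (fun p => by gcongr; exact hmax p.2) ?_
      · exact ne_top_of_le_ne_top hfin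
          ((ENNReal.tsum_le_tsum fun p => by gcongr; exact hmax p.2).trans hsum)
      · exact (ENNReal.mul_lt_mul_iff_right ha hM).2 hlt
    exact absurd (hstep u) (not_le.2 ((this.trans_le hsum).trans_eq hu.symm))
  have hns : y₀ ∉ 𝒴.stuck := fun h => hne (hzero _ (Or.inr h))
  simp only [stuck, Set.mem_ofPred_eq, not_forall, not_not] at hns
  obtain ⟨z, hz, hacc⟩ := hns
  have hdz : d z = d y₀ := by
    clear hacc
    induction hz with
    | refl => rfl
    | tail _ h ih => exact hsucc _ _ h ih
  exact hne (hdz ▸ hzero z (Or.inl hacc))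

theorem ae_not_undecided_add [Finite Y] (𝒴 : PBWA A Y) (k : ℕ) (y : Y) :
    𝒴.runMeasureFrom y {ρ | (fun n => ρ (n + k)) ∈ 𝒴.undecided} = 0 := by
  induction k generalizing y with
  | zero => exact 𝒴.runMeasureFrom_undecided y
  | succ k ih =>
    have hm : MeasurableSet {ρ : ℕ → A × Y | (fun n => ρ (n + (k + 1))) ∈ 𝒴.undecided} :=
      (measurable_pi_lambda (fun (ρ : ℕ → A × Y) n => ρ (n + (k + 1)))
        fun n => measurable_pi_apply _) 𝒴.measurableSet_undecided
    rw [runMeasureFrom_apply _ _ hm, ENNReal.tsum_eq_zero]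
    exact fun p => mul_eq_zero_of_right _ (ih p.2)

/-- Almost every run of a finite automaton reaches a stuck state or is accepting. -/
theorem ae_mem_accRun [Finite Y] (𝒴 : PBWA A Y) (y : Y) :
    ∀ᵐ ρ ∂𝒴.runMeasureFrom y, (∀ i, (ρ i).2 ∉ 𝒴.stuck) → ρ ∈ 𝒴.accRun := by
  have h : ∀ᵐ ρ ∂𝒴.runMeasureFrom y, ∀ k, (fun n => ρ (n + k)) ∉ 𝒴.undecided :=
    ae_all_iff.2 fun k => by
      rw [ae_iff]
      simpa using 𝒴.ae_not_undecided_add k y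
  filter_upwards [h] with ρ hρ hs
  rw [mem_accRun]
  intro k
  -- Without accepting states from time `k` on and without stuck states, the tail from `k` is
  -- undecided.
  by_contra! hc
  refine hρ k fun i hi => ?_
  rcases hi with hi | hi
  · exact hc (i + k) (by omega) hi
  · exact hs _ hi

/-! ### Soundness -/

/-- Trace inclusion, with acceptance ignored. The cylinder of length zero is the inequality for
nondivergence, and each further letter costs one simulation step. -/
theorem IsFairSimulation.tsum_trace_le [Countable Y] {𝒳 : PBWA A X} {𝒴 : PBWA A Y}
    {S : Matrix Y X ℝ≥0∞} (h : IsFairSimulation 𝒳 𝒴 S) (y : Y) {P : Set (ℕ → A)}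
    (hP : MeasurableSet P) :
    ∑' x, S y x * 𝒳.runMeasureFrom x (delSt ⁻¹' P) ≤ 𝒴.runMeasureFrom y (delSt ⁻¹' P) := by
  have hcyl : ∀ n y (v : ℕ → A),
      ∑' x, S y x * 𝒳.runMeasureFrom x (delSt ⁻¹' PiNat.cylinder v n) ≤
        𝒴.runMeasureFrom y (delSt ⁻¹' PiNat.cylinder v n) := by
    intro n
    induction n with
    | zero =>
      intro y v
      simpa [runMeasureFrom_univ] using h.noDiv_le y
    | succ n ih =>
      intro y v
      have hm := measurableSet_cylinder v (n + 1)
      simp_rw [runMeasureFrom_apply _ _ (measurable_delSt hm), preimage_delSt_cylinder]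
      refine (h.tsum_step_le y fun a x => 𝒳.runMeasureFrom x
        {ρ | a = v 0 ∧ ρ ∈ delSt ⁻¹' PiNat.cylinder (fun i => v (i + 1)) n}).trans ?_
      gcongr with q
      by_cases hq : q.1 = v 0
      · simp only [hq, true_and]
        exact ih q.2 fun i => v (i + 1)
      · simp [hq]
  have hle := measure_le_of_cylinder_le
    (Measure.sum fun x => S y x • (𝒳.runMeasureFrom x).map delSt)
    ((𝒴.runMeasureFrom y).map delSt) fun v n => by
      rw [Measure.sum_apply _ (measurableSet_cylinder v n),
        Measure.map_apply measurable_delSt (measurableSet_cylinder v n)]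
      simpa [Measure.map_apply measurable_delSt (measurableSet_cylinder v n)] using hcyl n y v
  have := hle P
  rw [Measure.sum_apply _ hP, Measure.map_apply measurable_delSt hP] at this
  simpa [Measure.map_apply measurable_delSt hP] using this

theorem measurableSet_forall_notMem [Countable Y] (k : ℕ) (Z : Set Y) :
    MeasurableSet {ρ : ℕ → A × Y | ∀ i ≤ k, (ρ i).2 ∉ Z} := by
  simp only [Set.ofPred_forall]
  exact MeasurableSet.iInter fun i => MeasurableSet.iInter fun _ =>
    measurable_pi_apply (X := fun _ => A × Y) i
      (MeasurableSet.of_discrete (s := {p : A × Y | p.2 ∉ Z}))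

/-- Acceptance is kept on the left for `k` steps so that the left side vanishes whenever the current
state of `𝒴` is stuck; only at the last state is it dropped, in favour of trace inclusion. -/
theorem IsFairSimulation.tsum_languageFrom_le_forall_notMem_stuck [Countable Y] {𝒳 : PBWA A X}
    {𝒴 : PBWA A Y} {S : Matrix Y X ℝ≥0∞} (h : IsFairSimulation 𝒳 𝒴 S) (k : ℕ) (y : Y)
    {P : Set (ℕ → A)} (hP : MeasurableSet P) :
    ∑' x, S y x * 𝒳.languageFrom x P ≤
      𝒴.runMeasureFrom y (delSt ⁻¹' P ∩ {ρ | ∀ i ≤ k, (ρ i).2 ∉ 𝒴.stuck}) := by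
  induction k generalizing y P with
  | zero =>
    by_cases hy : y ∈ 𝒴.stuck
    · simp [h.tsum_languageFrom_eq_zero hy P]
    · calc ∑' x, S y x * 𝒳.languageFrom x P
          ≤ ∑' x, S y x * 𝒳.runMeasureFrom x (delSt ⁻¹' P) := by
            gcongr with x
            exact measure_mono Set.inter_subset_left
        _ ≤ 𝒴.runMeasureFrom y (delSt ⁻¹' P) := h.tsum_trace_le y hP
        _ ≤ _ := by
            refine measure_mono_ae ?_
            filter_upwards [𝒴.ae_start y] with ρ h0 hρ
            refine ⟨hρ, fun i hi => ?_⟩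
            rw [Nat.le_zero.1 hi, h0]
            exact hy
  | succ k ih =>
    by_cases hy : y ∈ 𝒴.stuck
    · simp [h.tsum_languageFrom_eq_zero hy P]
    · have hm := (measurable_delSt (X := Y) hP).inter (measurableSet_forall_notMem (k + 1) 𝒴.stuck)
      rw [runMeasureFrom_apply _ _ hm]
      simp_rw [𝒳.languageFrom_eq_tsum _ hP]
      refine (h.tsum_step_le y fun a x => 𝒳.languageFrom x (consSeq a ⁻¹' P)).trans ?_
      gcongr with q
      refine (ih q.2 (measurable_consSeq q.1 hP)).trans (measure_mono ?_)
      rintro ρ ⟨h1, h2⟩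
      refine ⟨?_, fun i hi => ?_⟩
      · rw [Set.mem_preimage, delSt_consSeq]
        exact h1
      · cases i with
        | zero => exact hy
        | succ i => exact h2 i (by omega)

/-- Continuity from above lets `k` tend to infinity. Finiteness of `Y` then turns avoidance of stuck
states back into acceptance, almost surely. -/
theorem IsFairSimulation.tsum_languageFrom_le [Finite Y] {𝒳 : PBWA A X} {𝒴 : PBWA A Y}
    {S : Matrix Y X ℝ≥0∞} (h : IsFairSimulation 𝒳 𝒴 S) (y : Y) {P : Set (ℕ → A)}
    (hP : MeasurableSet P) : ∑' x, S y x * 𝒳.languageFrom x P ≤ 𝒴.languageFrom y P := by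
  have hanti : Antitone fun k => delSt ⁻¹' P ∩ {ρ : ℕ → A × Y | ∀ i ≤ k, (ρ i).2 ∉ 𝒴.stuck} :=
    fun k l hkl => Set.inter_subset_inter_right _ fun ρ hρ i hi => hρ i (hi.trans hkl)
  calc ∑' x, S y x * 𝒳.languageFrom x P
      ≤ ⨅ k, 𝒴.runMeasureFrom y (delSt ⁻¹' P ∩ {ρ | ∀ i ≤ k, (ρ i).2 ∉ 𝒴.stuck}) :=
        le_iInf fun k => h.tsum_languageFrom_le_forall_notMem_stuck k y hP
    _ = 𝒴.runMeasureFrom y (⋂ k, delSt ⁻¹' P ∩ {ρ | ∀ i ≤ k, (ρ i).2 ∉ 𝒴.stuck}) :=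
        (hanti.measure_iInter (fun k => ((measurable_delSt hP).inter
          (measurableSet_forall_notMem k _)).nullMeasurableSet) ⟨0, measure_ne_top _ _⟩).symm
    _ ≤ 𝒴.languageFrom y P := by
        refine measure_mono_ae ?_
        filter_upwards [𝒴.ae_mem_accRun y] with ρ hacc hρ
        have hρ' := Set.mem_iInter.1 hρ
        exact ⟨(hρ' 0).1, hacc fun i => (hρ' i).2 i le_rfl⟩

end Measure

end

end PBWA

/-! ### Inclusion of languages -/

theorem theorem4p13 {A X Y : Type*}
    [Countable A] [MeasurableSpace A] [DiscreteMeasurableSpace A]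
    [Countable X] [MeasurableSpace X] [DiscreteMeasurableSpace X]
    [Finite Y] [MeasurableSpace Y] [DiscreteMeasurableSpace Y]
    (𝒳 : PBWA A X) (𝒴 : PBWA A Y)
    (h : ∃ S : Matrix Y X ℝ≥0∞, PBWA.IsFairSimulation 𝒳 𝒴 S)
    (P : Set (ℕ → A)) (hP : MeasurableSet P) :
    𝒳.language P ≤ 𝒴.language P := by
  obtain ⟨S, hS⟩ := h
  rw [𝒳.language_eq_tsum hP, 𝒴.language_eq_tsum hP]
  calc ∑' x, 𝒳.init x * 𝒳.languageFrom x P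
      ≤ ∑' x, (∑' y, 𝒴.init y * S y x) * 𝒳.languageFrom x P := by
        gcongr with x
        exact hS.init_le x
    _ = ∑' y, 𝒴.init y * ∑' x, S y x * 𝒳.languageFrom x P := by
        simp_rw [← ENNReal.tsum_mul_right, ← ENNReal.tsum_mul_left, mul_assoc]
        exact ENNReal.tsum_comm
    _ ≤ ∑' y, 𝒴.init y * 𝒴.languageFrom y P := by
        gcongr with y
        exact hS.tsum_languageFrom_le y hP
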